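/- Let $G$ be a locally compact second countable (Hausdorff) group and let $\mu$ be an admissible Borel probability measure on $G$, i.e. $\mu$ is absolutely continuous with respect to the Haar measure and is not supported on a proper closed subsemigroup of $G$. Let $X$ be a Polish space with a continuous action of $G$, and let $K$ be a compact (Hausdorff) group acting continuously on $X$, such that the actions of $G$ and $K$ commute. Then the orbit space $X/K$, with the quotient topology and the induced $G$-action, is a Polish space with a continuous $G$-action, the quotient map $p:X\to X/K$ is a continuous $G$-equivariant surjection, and $X$ is $\mu$-stiff relative to $X/K$, in the following sense. Let $\nu$ be any Borel probability measure on $X$ that is $\mu$-stationary, meaning that $\mu*\nu=\nu$, where $\mu*\nu$ is the pushforward of $\mu\times\nu$ under the action map $G\times X\to X$, and ergodic, meaning that every Borel set $A\subseteq X$ with $g^{-1}A=A$ for all $g\in G$ has $\nu(A)\in\{0,1\}$. Then every $g\in G$ preserves the measure class of $\nu$, and $X$ is measure preserving relative to $X/K$ with respect to $\nu$: there is a disintegration of $\nu$ along $p$, i.e. a measurable map $y\mapsto\nu_y$ from $X/K$ to the Borel probability measures on $X$ with $\nu_y(p^{-1}(y))=1$ for $p_*\nu$-almost every $y$ and $\nu=\int_{X/K}\nu_y\,dp_*\nu(y)$,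 and every such disintegration is $G$-equivariant: for every $g\in G$ one has $\nu_{gy}=g_*\nu_y$ for $p_*\nu$-almost every $y\in X/K$. -/

import Mathlib

open MeasureTheory ProbabilityTheory

/-! ### Orbit spaces of compact group actions -/

section OrbitSpace

variable {G K X : Type*} [Group G] [Group K] [MulAction G X] [MulAction K X]

/-- If the actions of `G` and `K` on `X` commute, then `G` acts on the orbit space `X/K`
by `g • [x] = [g • x]`. -/
instance orbitSpaceMulAction [SMulCommClass G K X] :
    MulAction G (MulAction.orbitRel.Quotient K X) where
  smul g := Quotient.map (fun x => g • x) (by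
    rintro a b ⟨k, rfl⟩
    exact ⟨k, (smul_comm g k b).symm⟩)
  one_smul y := by
    induction y using Quotient.inductionOn with
    | h x => exact congrArg (Quotient.mk _) (one_smul G x)
  mul_smul g h y := by
    induction y using Quotient.inductionOn with
    | h x => exact congrArg (Quotient.mk _) (mul_smul g h x)

theorem orbitSpace_smul_mk [SMulCommClass G K X] (g : G) (x : X) :
    g • (Quotient.mk (MulAction.orbitRel K X) x) = Quotient.mk (MulAction.orbitRel K X) (g • x) :=
  rfl

variable [TopologicalSpace G] [TopologicalSpace K] [TopologicalSpace X]

/-- The action on the orbit space is (jointly) continuous. -/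
instance orbitSpaceContinuousSMul [SMulCommClass G K X] [ContinuousSMul G X]
    [ContinuousConstSMul K X] : ContinuousSMul G (MulAction.orbitRel.Quotient K X) where
  continuous_smul := by
    have hq : IsOpenQuotientMap (Quotient.mk (MulAction.orbitRel K X)) :=
      MulAction.isOpenQuotientMap_quotientMk
    have h := (IsOpenQuotientMap.id (X := G)).prodMap hq
    rw [h.isQuotientMap.continuous_iff]
    exact hq.continuous.comp (continuous_smul (M := G) (X := X))

variable (K) in
/-- The orbit of a point under a compact group, as a nonempty compact set. -/
def compactOrbit [CompactSpace K] [ContinuousSMul K X] (x : X) :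
    TopologicalSpace.NonemptyCompacts X where
  carrier := MulAction.orbit K x
  isCompact' := isCompact_range (continuous_id.smul continuous_const)
  nonempty' := MulAction.nonempty_orbit x

theorem coe_compactOrbit [CompactSpace K] [ContinuousSMul K X] (x : X) :
    (compactOrbit K x : Set X) = MulAction.orbit K x := rfl

theorem compactOrbit_eq_iff [CompactSpace K] [ContinuousSMul K X] {x y : X} :
    compactOrbit K x = compactOrbit K y ↔ x ∈ MulAction.orbit K y := by
  rw [← SetLike.coe_set_eq, coe_compactOrbit, coe_compactOrbit, MulAction.orbit_eq_iff]

theorem continuous_compactOrbit [CompactSpace K] [ContinuousSMul K X] :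
    Continuous (compactOrbit K : X → TopologicalSpace.NonemptyCompacts X) := by
  have hc (k : K) : Continuous fun x : X => k • x := continuous_const_smul k
  let := TopologicalSpace.vietoris X
  rw [TopologicalSpace.NonemptyCompacts.isEmbedding_coe.continuous_iff,
    TopologicalSpace.vietoris.continuous_iff]
  have key (S : Set X) : (((↑) : TopologicalSpace.NonemptyCompacts X → Set X) ∘
      (compactOrbit K : X → TopologicalSpace.NonemptyCompacts X)) ⁻¹' S.powerset
        = {x : X | ∀ k : K, k • x ∈ S} := by
    ext x
    exact ⟨fun h k => h ⟨k, rfl⟩, by rintro h _ ⟨k, rfl⟩; exact h k⟩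
  constructor
  · intro U hU
    rw [key, ← isClosed_compl_iff]
    have hcl : IsClosed {p : X × K | p.2 • p.1 ∈ Uᶜ} :=
      hU.isClosed_compl.preimage (continuous_snd.smul continuous_fst)
    have himg := isClosedMap_fst_of_compactSpace _ hcl
    convert himg using 1
    ext x
    simp
  · intro F hF
    rw [key, Set.ofPred_forall]
    exact isClosed_iInter fun k => hF.preimage (hc k)

theorem isClosed_range_compactOrbit [CompactSpace K] [ContinuousSMul K X] [T2Space X] :
    IsClosed (Set.range (compactOrbit K : X → TopologicalSpace.NonemptyCompacts X)) := by
  rw [← closure_subset_iff_isClosed]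
  intro C hC
  obtain ⟨y, hy⟩ := C.nonempty
  refine ⟨y, ?_⟩
  by_contra hne
  obtain ⟨W₁, W₂, h₁, h₂, hy₁, hC₂, hd⟩ := t2_separation hne
  have hV : IsOpen ((compactOrbit K : X → _) ⁻¹' W₁) := h₁.preimage continuous_compactOrbit
  have hN := h₂.inter (TopologicalSpace.NonemptyCompacts.isOpen_inter_nonempty_of_isOpen hV)
  obtain ⟨_, ⟨hD₂, z, hz, hz₁⟩, ⟨w, rfl⟩⟩ := mem_closure_iff.mp hC _ hN ⟨hC₂, y, hy, hy₁⟩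
  have hzw : compactOrbit K z = compactOrbit K w := compactOrbit_eq_iff.mpr hz
  rw [Set.mem_preimage, hzw] at hz₁
  exact Set.disjoint_left.mp hd hz₁ hD₂

/-- The orbit space of a continuous action of a compact group on a Polish space is Polish. -/
instance orbitSpacePolishSpace [CompactSpace K] [ContinuousSMul K X] [PolishSpace X] :
    PolishSpace (MulAction.orbitRel.Quotient K X) := by
  have hP : PolishSpace (TopologicalSpace.NonemptyCompacts X) := by
    let := TopologicalSpace.upgradeIsCompletelyMetrizable X
    infer_instance
  let f : MulAction.orbitRel.Quotient K X → TopologicalSpace.NonemptyCompacts X :=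
    Quotient.lift (compactOrbit K) fun a b h => compactOrbit_eq_iff.mpr h
  have hf : ∀ x : X, f (Quotient.mk _ x) = compactOrbit K x := fun _ => rfl
  have hcont : Continuous f := continuous_compactOrbit.quotient_lift _
  have hinj : Function.Injective f := by
    intro a b
    induction a using Quotient.inductionOn
    induction b using Quotient.inductionOn
    intro h
    exact Quotient.sound (compactOrbit_eq_iff.mp h)
  have hclosed : IsClosedMap f := by
    intro A hA
    have hA' : IsClosed (Quotient.mk (MulAction.orbitRel K X) ⁻¹' A) :=
      hA.preimage continuous_quotient_mk'
    convert isClosed_range_compactOrbit.inter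
      (TopologicalSpace.NonemptyCompacts.isClosed_subsets_of_isClosed hA') using 1
    ext C
    constructor
    · rintro ⟨a, ha, rfl⟩
      induction a using Quotient.inductionOn with
      | h x =>
        refine ⟨⟨x, rfl⟩, ?_⟩
        rintro _ ⟨k, rfl⟩
        have : Quotient.mk (MulAction.orbitRel K X) (k • x) = Quotient.mk _ x :=
          Quotient.sound ⟨k, rfl⟩
        change Quotient.mk (MulAction.orbitRel K X) (k • x) ∈ A
        rwa [this]
    · rintro ⟨⟨x, rfl⟩, hx⟩
      exact ⟨Quotient.mk _ x, hx (MulAction.mem_orbit_self x), rfl⟩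
  exact (Topology.IsClosedEmbedding.of_continuous_injective_isClosedMap
    hcont hinj hclosed).polishSpace

instance orbitSpaceBorelSpace [CompactSpace K] [ContinuousSMul K X] [PolishSpace X]
    [MeasurableSpace X] [BorelSpace X] : BorelSpace (MulAction.orbitRel.Quotient K X) :=
  inferInstance

end OrbitSpace

/-! ### Stationary measures and relative stiffness -/

section Stiffness

/-- A probability measure `μ` on a locally compact group is admissible if it is absolutely
continuous with respect to the Haar measure and is not supported on a proper closed
subsemigroup. -/
def IsAdmissible {G : Type*} [Group G] [TopologicalSpace G] [IsTopologicalGroup G]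
    [LocallyCompactSpace G] [MeasurableSpace G] [BorelSpace G] (μ : Measure G) : Prop :=
  μ ≪ Measure.haar ∧ ∀ S : Subsemigroup G, IsClosed (S : Set G) → μ (S : Set G)ᶜ = 0 → S = ⊤

variable {G X Y : Type*} [Group G] [MeasurableSpace G]
  [MulAction G X] [MeasurableSpace X] [MulAction G Y] [MeasurableSpace Y]

/-- `ν` is `μ`-stationary if `μ * ν = ν`, where the convolution `μ * ν` is the pushforward of
`μ × ν` under the action map `G × X → X`. -/
def IsStationaryMeasure (μ : Measure G) (ν : Measure X) : Prop :=
  (μ.prod ν).map (fun q : G × X => q.1 • q.2) = ν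

variable (G) in
/-- Every element of `G` preserves the measure class of `ν`. -/
def PreservesMeasureClass (ν : Measure X) : Prop :=
  ∀ g : G, ν.map (fun x => g • x) ≪ ν ∧ ν ≪ ν.map (fun x => g • x)

variable (G) in
/-- Every `G`-invariant measurable set is null or conull. -/
def IsErgodicMeasure (ν : Measure X) : Prop :=
  ∀ A : Set X, MeasurableSet A → (∀ g : G, (fun x => g • x) ⁻¹' A = A) → ν A = 0 ∨ ν Aᶜ = 0

/-- `κ` is a disintegration `y ↦ ν_y` of `ν` along `p`: a measurable family of probability
measures, with `ν_y` carried by the fibre `p⁻¹(y)` for almost every `y`, and `ν = ∫ ν_y d(p_*ν)`. -/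
structure IsDisintegration (p : X → Y) (ν : Measure X) (κ : Kernel Y X) : Prop where
  isMarkovKernel : IsMarkovKernel κ
  ae_fiber : ∀ᵐ y ∂(ν.map p), κ y (p ⁻¹' {y})ᶜ = 0
  bind_eq : (ν.map p).bind κ = ν

variable (G) in
/-- The disintegration `κ` is `G`-equivariant as an almost everywhere defined map: for every `g`,
one has `ν_{g y} = g_* ν_y` for almost every `y`. -/
def IsEquivariantDisintegration (p : X → Y) (ν : Measure X) (κ : Kernel Y X) : Prop :=
  ∀ g : G, ∀ᵐ y ∂(ν.map p), κ (g • y) = (κ y).map (fun x => g • x)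

variable (G) in
/-- `(X, ν)` is measure preserving relative to `Y`: `G` preserves the measure class of `ν`, and
the disintegration of `ν` along `p` (which exists, and is unique up to null sets) is
`G`-equivariant. -/
structure IsMeasurePreservingRelative (p : X → Y) (ν : Measure X) : Prop where
  preservesMeasureClass : PreservesMeasureClass G ν
  exists_disintegration : ∃ κ : Kernel Y X, IsDisintegration p ν κ
  equivariant : ∀ κ : Kernel Y X, IsDisintegration p ν κ → IsEquivariantDisintegration G p ν κ

/-- Let `X` and `Y` be Polish `G`-spaces. `X` is `μ`-stiff relative to `Y` along `p` if `p` is a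
continuous `G`-equivariant surjection and `X` is measure preserving relative to `Y` with respect
to every ergodic `μ`-stationary probability measure. -/
structure IsStiffRelativeTo [TopologicalSpace G] [TopologicalSpace X] [TopologicalSpace Y]
    [PolishSpace X] [BorelSpace X] [ContinuousSMul G X]
    [PolishSpace Y] [BorelSpace Y] [ContinuousSMul G Y]
    (μ : Measure G) (p : X → Y) : Prop where
  continuous : Continuous p
  surjective : Function.Surjective p
  map_smul : ∀ (g : G) (x : X), p (g • x) = g • p x
  isMeasurePreservingRelative : ∀ ν : Measure X, IsProbabilityMeasure ν → IsStationaryMeasure μ ν →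
    IsErgodicMeasure G ν → IsMeasurePreservingRelative G p ν

end Stiffness

/-! Run the random walk on `X` driven by `μ`. By the mean ergodic theorem on L²(ν), along a fixed
sequence of times the Cesàro averages of its law converge weakly to ν from ν-almost every starting
point; call such points generic (`exists_generic_set`). The action of K commutes with the walk, so
if x and kx are both generic, then k preserves ν (`map_eq_self_of_tendsto_walkAverage`). Hence
almost all of a typical fibre measure sits on a single orbit of the stabilizer L of ν in K.

Let h(x) be the image of the Haar probability measure of L under l ↦ lx. Averaging a disintegration
κ by h gives another disintegration, because L preserves ν and moves points inside fibres. By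
uniqueness it equals κ almost everywhere; since h is constant on L-orbits, κ(p x) = h(x) for almost
every x (`IsDisintegration.ae_eq_walkStep`). As h commutes with G and G preserves the class of ν,
equivariance follows.

Quasi-invariance uses admissibility: g ↦ ν(g⁻¹A) is harmonic, hence continuous, so the g with gν ≪ ν
form a closed subsemigroup of full μ-measure. Dividing K by its ineffective kernel reduces to second
countable K. -/

theorem IsStationaryMeasure.measurePreserving {G X : Type*} [Group G] [MeasurableSpace G]
    [MulAction G X] [MeasurableSpace X] [MeasurableSMul₂ G X] {μ : Measure G} {ν : Measure X}
    (h : IsStationaryMeasure μ ν) :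
    MeasurePreserving (fun q : G × X => q.1 • q.2) (μ.prod ν) ν :=
  ⟨measurable_smul, h⟩

/-! ### Stationary measures are quasi-invariant. -/

section QuasiInvariance

open Filter Topology

set_option linter.unusedSectionVars false

variable {G : Type*} [Group G] [TopologicalSpace G] [IsTopologicalGroup G] [LocallyCompactSpace G]
  [SecondCountableTopology G] [T2Space G] [MeasurableSpace G] [BorelSpace G]

/-- Integrating against `v ↦ v f` with `f` bounded is continuous on `L¹`. -/
theorem continuous_integral_mul_of_bounded {α : Type*} [MeasurableSpace α] {m : Measure α}
    {f : α → ℝ} (hf : Measurable f) {C : NNReal} (hC : ∀ a, |f a| ≤ C) :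
    Continuous fun v : Lp ℝ 1 m => ∫ a, v a * f a ∂m := by
  have hint (v : Lp ℝ 1 m) : Integrable (fun a => v a * f a) m :=
    (L1.integrable_coeFn v).mul_bdd (c := C) hf.aestronglyMeasurable (.of_forall hC)
  refine (LipschitzWith.of_dist_le_mul (K := C) fun v w => ?_).continuous
  rw [dist_eq_norm, dist_eq_norm, ← integral_sub (hint v) (hint w), L1.norm_eq_integral_norm,
    ← integral_const_mul]
  refine (norm_integral_le_integral_norm _).trans (integral_mono_ae ?_ ?_ ?_)
  · exact ((hint v).sub (hint w)).norm
  · exact (L1.integrable_coeFn (v - w)).norm.const_mul _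
  · filter_upwards [Lp.coeFn_sub v w] with a ha
    rw [ha, Pi.sub_apply, ← sub_mul, norm_mul, mul_comm]
    exact mul_le_mul_of_nonneg_right (hC a) (norm_nonneg _)

/-- Convolving a bounded function with an absolutely continuous measure gives a continuous
function. -/
theorem continuous_integral_mul_left_of_absolutelyContinuous {μ : Measure G}
    [IsProbabilityMeasure μ] (hμ : μ ≪ Measure.haar) {f : G → ℝ} (hf : Measurable f) {C : NNReal}
    (hC : ∀ a, |f a| ≤ C) :
    Continuous fun h : G => ∫ g, f (h * g) ∂μ := by
  let m : Measure G := Measure.haar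
  have : Fact ((1 : ENNReal) ≠ ⊤) := ⟨ENNReal.one_ne_top⟩
  let φ : G → ℝ := fun g => (μ.rnDeriv m g).toReal
  have hφ : MemLp φ 1 m := memLp_one_iff_integrable.mpr Measure.integrable_toReal_rnDeriv
  -- With φ the density of `μ`, left invariance turns ∫ f(hg) dμ(g) into ∫ φ(h⁻¹y) f(y) dm(y), so
  -- the claim reduces to continuity of translation in L¹.
  have hcont : Continuous fun h : G => (DomMulAct.mk h⁻¹ • hφ.toLp φ : Lp ℝ 1 m) :=
    (DomMulAct.continuous_mk.comp continuous_inv).smul continuous_const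
  refine ((continuous_integral_mul_of_bounded hf hC).comp hcont).congr fun h => ?_
  rw [Function.comp_apply, DomMulAct.mk_smul_toLp, ← integral_rnDeriv_smul hμ]
  trans ∫ y, φ (h⁻¹ * y) * f y ∂m
  · refine integral_congr_ae ?_
    filter_upwards [MemLp.coeFn_toLp (hφ.comp_measurePreserving (measurePreserving_smul h⁻¹ m))]
      with g hg
    exact congrArg (· * f g) hg
  · rw [← integral_mul_left_eq_self _ h]
    simp [φ, m]

variable {X : Type*} [MeasurableSpace X] [MulAction G X] [MeasurableSMul₂ G X]

/-- Stationarity evaluated on g⁻¹A makes g ↦ ν(g⁻¹A) harmonic for right multiplication by `μ`-random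
elements. -/
theorem IsStationaryMeasure.measureReal_preimage_smul {μ : Measure G} [IsProbabilityMeasure μ]
    {ν : Measure X} [IsProbabilityMeasure ν] (h : IsStationaryMeasure μ ν) {A : Set X}
    (hA : MeasurableSet A) (g : G) :
    ν.real ((fun x => g • x) ⁻¹' A) = ∫ s, ν.real ((fun x => (g * s) • x) ⁻¹' A) ∂μ := by
  have hm : MeasurableSet ((fun x : X => g • x) ⁻¹' A) := measurable_const_smul g hA
  rw [← h.measurePreserving.measureReal_preimage hm.nullMeasurableSet,
    measureReal_def, Measure.prod_apply (h.measurePreserving.measurable hm), ← integral_toReal]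
  · refine integral_congr_ae (.of_forall fun s => ?_)
    simp only [Set.preimage_preimage, mul_smul, measureReal_def]
  · exact (measurable_measure_prodMk_left (measurable_smul hm)).aemeasurable
  · exact .of_forall fun s => measure_lt_top _ _

/-- A bounded harmonic function equals its own average against the absolutely continuous `μ`, and
such averages are continuous. -/
theorem IsStationaryMeasure.continuous_measureReal_preimage_smul {μ : Measure G}
    [IsProbabilityMeasure μ] (hμ : μ ≪ Measure.haar) {ν : Measure X} [IsProbabilityMeasure ν]
    (h : IsStationaryMeasure μ ν) {A : Set X} (hA : MeasurableSet A) :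
    Continuous fun g : G => ν.real ((fun x => g • x) ⁻¹' A) := by
  have hmeas : Measurable fun g : G => ν.real ((fun x => g • x) ⁻¹' A) :=
    (measurable_measure_prodMk_left (measurable_smul hA)).ennreal_toReal
  refine (continuous_integral_mul_left_of_absolutelyContinuous hμ hmeas (C := 1)
    fun a => ?_).congr fun g => (h.measureReal_preimage_smul hA g).symm
  rw [abs_of_nonneg measureReal_nonneg]
  exact measureReal_le_one

theorem IsStationaryMeasure.map_smul_absolutelyContinuous {μ : Measure G}
    [IsProbabilityMeasure μ] (hμ : IsAdmissible μ) {ν : Measure X} [IsProbabilityMeasure ν]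
    (h : IsStationaryMeasure μ ν) (g : G) : ν.map (fun x => g • x) ≪ ν := by
  have hms (g : G) : Measurable fun x : X => g • x := measurable_const_smul g
  let S : Subsemigroup G :=
    { carrier := {g | ν.map (fun x => g • x) ≪ ν}
      mul_mem' := by
        intro a b ha hb
        have : ν.map (fun x => (a * b) • x) = (ν.map fun x => b • x).map fun x => a • x := by
          rw [Measure.map_map (hms a) (hms b)]
          simp only [mul_smul, Function.comp_def]
        rw [Set.mem_ofPred_eq, this]
        exact (hb.map (hms a)).trans ha }
  let F (A : Set X) : Set G := {g | ν.real ((fun x => g • x) ⁻¹' A) = 0}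
  have hF {A : Set X} (hA : MeasurableSet A) : IsClosed (F A) :=
    isClosed_eq (h.continuous_measureReal_preimage_smul hμ.1 hA) continuous_const
  have hS : (S : Set G) = ⋂ (A : Set X) (_ : MeasurableSet A) (_ : ν A = 0), F A := by
    ext g
    simp only [Set.mem_iInter]
    refine ⟨fun hg A hA h0 => ?_, fun hg => Measure.AbsolutelyContinuous.mk fun A hA h0 => ?_⟩
    · have := hg h0
      rw [Measure.map_apply (hms g) hA] at this
      simp [F, measureReal_def, this]
    · rw [Measure.map_apply (hms g) hA]
      exact (measureReal_eq_zero_iff).mp (hg A hA h0)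
  have hcl : IsClosed (S : Set G) := by
    rw [hS]
    exact isClosed_iInter fun A => isClosed_iInter fun hA => isClosed_iInter fun _ => hF hA
  have hnull : μ (S : Set G)ᶜ = 0 := by
    -- `S` is a possibly uncountable intersection of conull sets, so nullity of the complement goes
    -- through the support of `μ`, which lies in every closed conull set.
    refine measure_mono_null (Set.compl_subset_compl.mpr ?_) (Measure.measure_compl_support (μ := μ))
    rw [hS]
    refine Set.subset_iInter fun A => Set.subset_iInter fun hA => Set.subset_iInter fun h0 =>
      Measure.support_subset_of_isClosed (hF hA) ?_
    have h1 := h.measurePreserving.quasiMeasurePreserving.preimage_null h0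
    have h2 := Measure.ae_ae_of_ae_prod (measure_eq_zero_iff_ae_notMem.mp h1)
    filter_upwards [h2] with g hg
    rw [Set.mem_ofPred_eq, measureReal_eq_zero_iff]
    exact measure_eq_zero_iff_ae_notMem.mpr hg
  have hg : g ∈ S := by rw [hμ.2 S hcl hnull]; trivial
  exact hg

theorem IsStationaryMeasure.preservesMeasureClass {μ : Measure G}
    [IsProbabilityMeasure μ] (hμ : IsAdmissible μ) {ν : Measure X} [IsProbabilityMeasure ν]
    (h : IsStationaryMeasure μ ν) : PreservesMeasureClass G ν := by
  refine fun g => ⟨h.map_smul_absolutelyContinuous hμ g, ?_⟩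
  have := (h.map_smul_absolutelyContinuous hμ g⁻¹).map (measurable_const_smul g)
  rwa [Measure.map_map (measurable_const_smul g) (measurable_const_smul g⁻¹),
    show ((fun x : X => g • x) ∘ fun x => g⁻¹ • x) = id from funext fun x => smul_inv_smul g x,
    Measure.map_id] at this

end QuasiInvariance

/-! ### Almost invariant sets and functions under an ergodic measure. -/

section AlmostInvariantSets

open Filter Topology

set_option linter.unusedSectionVars false

variable {G : Type*} [Group G] [TopologicalSpace G] [IsTopologicalGroup G] [LocallyCompactSpace G]
  [SecondCountableTopology G] [T2Space G] [MeasurableSpace G] [BorelSpace G]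
  {X : Type*} [MeasurableSpace X] [MulAction G X] [MeasurableSMul₂ G X]

theorem PreservesMeasureClass.quasiMeasurePreserving {ν : Measure X}
    (h : PreservesMeasureClass G ν) (g : G) :
    Measure.QuasiMeasurePreserving (fun x => g • x) ν ν :=
  ⟨measurable_const_smul g, (h g).1⟩

/-- The elements of `G` fixing the set `A` up to a null set. -/
def almostStabilizer {ν : Measure X} (h : PreservesMeasureClass G ν) (A : Set X) : Subgroup G where
  carrier := {g | ∀ᵐ x ∂ν, g • x ∈ A ↔ x ∈ A}
  one_mem' := by
    rw [Set.mem_ofPred_eq]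
    exact .of_forall fun x => by rw [one_smul]
  mul_mem' := by
    intro a b ha hb
    rw [Set.mem_ofPred_eq] at ha hb ⊢
    filter_upwards [(h.quasiMeasurePreserving b).ae ha, hb] with x hx hx'
    rw [mul_smul, hx, hx']
  inv_mem' := by
    intro a ha
    rw [Set.mem_ofPred_eq] at ha ⊢
    filter_upwards [(h.quasiMeasurePreserving a⁻¹).ae ha] with x hx
    rw [← hx, smul_inv_smul]

/-- The almost stabilizer is `μ`-conull, hence of positive Haar measure as `μ` is absolutely
continuous. By Steinhaus it is open, hence closed, and admissibility finishes. -/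
theorem almostStabilizer_eq_top {μ : Measure G} [IsProbabilityMeasure μ] (hμ : IsAdmissible μ)
    {ν : Measure X} [IsProbabilityMeasure ν] (h : PreservesMeasureClass G ν) {A : Set X}
    (hA : MeasurableSet A) (hinv : ∀ᵐ g ∂μ, ∀ᵐ x ∂ν, g • x ∈ A ↔ x ∈ A) :
    almostStabilizer h A = ⊤ := by
  set S := almostStabilizer h A
  have hmeas : MeasurableSet (S : Set G) := by
    have : MeasurableSet {q : G × X | ¬ (q.1 • q.2 ∈ A ↔ q.2 ∈ A)} :=
      ((measurable_smul hA).iff (measurable_snd hA)).compl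
    exact measurable_measure_prodMk_left this (measurableSet_singleton 0)
  have hnull : μ (S : Set G)ᶜ = 0 := hinv
  have hpos : 0 < Measure.haar (S : Set G) := by
    refine pos_iff_ne_zero.mpr fun h0 => ?_
    have h1 := measure_univ_le_add_compl (μ := μ) (S : Set G)
    rw [hμ.1 h0, hnull, measure_univ] at h1
    simp at h1
  have hnhds : (S : Set G) ∈ 𝓝 1 := by
    refine mem_of_superset (Measure.div_mem_nhds_one_of_haar_pos Measure.haar _ hmeas hpos) ?_
    rintro _ ⟨a, ha, b, hb, rfl⟩
    exact S.div_mem ha hb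
  have hcl : IsClosed (S : Set G) := S.isClosed_of_isOpen (S.isOpen_of_mem_nhds hnhds)
  have htop := hμ.2 S.toSubsemigroup hcl hnull
  exact eq_top_iff.mpr fun g _ => (htop ▸ Subsemigroup.mem_top g : g ∈ S.toSubsemigroup)

/-- A measurable set which is invariant up to null sets is almost equal to an invariant one. -/
theorem exists_invariant_ae_eq {ν : Measure X} [IsProbabilityMeasure ν] {A : Set X}
    (hA : MeasurableSet A) (hinv : ∀ g : G, ∀ᵐ x ∂ν, g • x ∈ A ↔ x ∈ A) :
    ∃ B : Set X, MeasurableSet B ∧ (∀ g : G, (fun x => g • x) ⁻¹' B = B) ∧ A =ᵐ[ν] B := by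
  let m : Measure G := Measure.haar
  -- This set is exactly invariant because right translations preserve Haar-null sets; Fubini shows
  -- that it agrees with `A` almost everywhere.
  refine ⟨{x | ∀ᵐ g ∂m, g • x ∈ A}, ?_, ?_, ?_⟩
  · have : MeasurableSet {q : X × G | ¬ q.2 • q.1 ∈ A} :=
      ((measurable_snd.smul measurable_fst) hA).compl
    exact measurable_measure_prodMk_left this (measurableSet_singleton 0)
  · have key (g : G) (x : X) (hx : ∀ᵐ s ∂m, s • x ∈ A) : ∀ᵐ s ∂m, s • g • x ∈ A := by
      filter_upwards [(quasiMeasurePreserving_mul_right m g).ae hx] with s hs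
      rwa [← mul_smul]
    intro g
    ext x
    refine ⟨fun hx => ?_, key g x⟩
    simpa only [inv_smul_smul, Set.mem_ofPred_eq] using key g⁻¹ _ hx
  · have hm : MeasurableSet {q : G × X | q.1 • q.2 ∈ A ↔ q.2 ∈ A} :=
      (measurable_smul hA).iff (measurable_snd hA)
    have h1 := (Measure.ae_ae_comm (μ := m) (ν := ν) hm).mp (.of_forall hinv)
    filter_upwards [h1] with x hx
    refine propext ⟨fun hxA => ?_, fun hxB => ?_⟩
    · filter_upwards [hx] with g hg using hg.mpr hxA
    · obtain ⟨g, h2, h3⟩ := (hx.and hxB).exists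
      exact h2.mp h3

theorem IsErgodicMeasure.measure_eq_zero_or {μ : Measure G} [IsProbabilityMeasure μ]
    (hμ : IsAdmissible μ) {ν : Measure X} [IsProbabilityMeasure ν] (hst : IsStationaryMeasure μ ν)
    (herg : IsErgodicMeasure G ν) {A : Set X} (hA : MeasurableSet A)
    (hinv : ∀ᵐ q ∂(μ.prod ν), q.1 • q.2 ∈ A ↔ q.2 ∈ A) : ν A = 0 ∨ ν Aᶜ = 0 := by
  have htop := almostStabilizer_eq_top hμ (hst.preservesMeasureClass hμ) hA
    (Measure.ae_ae_of_ae_prod hinv)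
  obtain ⟨B, hB, hBinv, hAB⟩ := exists_invariant_ae_eq hA fun g =>
    (htop ▸ Subgroup.mem_top g : g ∈ almostStabilizer (hst.preservesMeasureClass hμ) A)
  rw [measure_congr hAB, measure_congr hAB.compl]
  exact herg B hB hBinv

/-- An almost invariant function is almost constant. -/
theorem IsErgodicMeasure.exists_ae_eq_const {μ : Measure G} [IsProbabilityMeasure μ]
    (hμ : IsAdmissible μ) {ν : Measure X} [IsProbabilityMeasure ν] (hst : IsStationaryMeasure μ ν)
    (herg : IsErgodicMeasure G ν) {f : X → ℝ} (hf : Measurable f)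
    (hinv : ∀ᵐ q ∂(μ.prod ν), f (q.1 • q.2) = f q.2) : ∃ c, f =ᵐ[ν] Function.const X c := by
  refine exists_eventuallyEq_const_of_forall_separating MeasurableSet fun U hU => ?_
  have := herg.measure_eq_zero_or hμ hst (hf hU) (hinv.mono fun q hq => by
    rw [Set.mem_preimage, Set.mem_preimage, hq])
  rcases this with h0 | h0
  · exact .inr (measure_eq_zero_iff_ae_notMem.mp h0)
  · exact .inl (by simpa using measure_eq_zero_iff_ae_notMem.mp h0)

end AlmostInvariantSets

/-! ### The random walk and its Markov operator on L²(ν). -/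

section RandomWalk

open Filter Topology

set_option linter.unusedSectionVars false

variable {G : Type*} [Group G] [MeasurableSpace G]
  {X : Type*} [MeasurableSpace X] [MulAction G X] [MeasurableSMul₂ G X]

variable (X) in
/-- One step of the random walk on `X` driven by `μ`. -/
noncomputable def walkStep (μ : Measure G) : Kernel X X :=
  ((Kernel.const X μ) ×ₖ Kernel.id).map fun q : G × X => q.1 • q.2

theorem walkStep_apply (μ : Measure G) [IsProbabilityMeasure μ] (x : X) :
    walkStep X μ x = μ.map fun g => g • x := by
  have hm : Measurable fun q : G × X => q.1 • q.2 := measurable_smul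
  rw [walkStep, Kernel.map_apply _ hm, Kernel.prod_apply, Kernel.const_apply,
    Kernel.id_apply, Measure.prod_dirac, Measure.map_map hm (by fun_prop)]
  rfl

instance (μ : Measure G) [IsProbabilityMeasure μ] : IsMarkovKernel (walkStep X μ) :=
  Kernel.IsMarkovKernel.map _ measurable_smul

variable (X) in
/-- The law of the random walk on `X` driven by `μ` after `n` steps. -/
noncomputable def walkLaw (μ : Measure G) : ℕ → Kernel X X
  | 0 => Kernel.id
  | n + 1 => walkLaw μ n ∘ₖ walkStep X μ

instance (μ : Measure G) [IsProbabilityMeasure μ] (n : ℕ) : IsMarkovKernel (walkLaw X μ n) := by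
  induction n with
  | zero => exact inferInstanceAs (IsMarkovKernel Kernel.id)
  | succ n ih => exact inferInstanceAs (IsMarkovKernel (walkLaw X μ n ∘ₖ walkStep X μ))

theorem walkLaw_succ_apply (μ : Measure G) [IsProbabilityMeasure μ] (n : ℕ) (x : X) {B : Set X}
    (hB : MeasurableSet B) :
    walkLaw X μ (n + 1) x B = ∫⁻ g, walkLaw X μ n (g • x) B ∂μ := by
  rw [walkLaw, Kernel.comp_apply' _ _ _ hB, walkStep_apply,
    lintegral_map (Kernel.measurable_coe _ hB) (by fun_prop)]

theorem walkLaw_succ_real (μ : Measure G) [IsProbabilityMeasure μ] (n : ℕ) (x : X) {B : Set X}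
    (hB : MeasurableSet B) :
    (walkLaw X μ (n + 1) x).real B = ∫ g, (walkLaw X μ n (g • x)).real B ∂μ := by
  simp only [measureReal_def]
  rw [walkLaw_succ_apply μ n x hB, integral_toReal]
  · exact ((Kernel.measurable_coe _ hB).comp (measurable_smul_const x)).aemeasurable
  · exact .of_forall fun g => measure_lt_top _ _

/-- The Cesàro averages of the laws of the random walk. -/
noncomputable def walkAverage (μ : Measure G) (N : ℕ) (x : X) : Measure X :=
  -- Taking N + 1 terms makes this a probability measure already at N = 0.
  (N + 1 : ENNReal)⁻¹ • ∑ n ∈ Finset.range (N + 1), walkLaw X μ n x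

instance (μ : Measure G) [IsProbabilityMeasure μ] (N : ℕ) (x : X) :
    IsProbabilityMeasure (walkAverage μ N x) := by
  constructor
  rw [walkAverage, Measure.smul_apply, Measure.finsetSum_apply]
  simp only [measure_univ, Finset.sum_const, Finset.card_range, nsmul_eq_mul, mul_one,
    smul_eq_mul, Nat.cast_add, Nat.cast_one]
  exact ENNReal.inv_mul_cancel (by simp) (by finiteness)

theorem walkAverage_real (μ : Measure G) [IsProbabilityMeasure μ] (N : ℕ) (x : X) (B : Set X) :
    (walkAverage μ N x).real B
      = ((N + 1 : ℕ) : ℝ)⁻¹ * ∑ n ∈ Finset.range (N + 1), (walkLaw X μ n x).real B := by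
  rw [walkAverage, measureReal_def, Measure.smul_apply, Measure.finsetSum_apply, smul_eq_mul,
    ENNReal.toReal_mul, ENNReal.toReal_sum fun _ _ => measure_ne_top _ _, ENNReal.toReal_inv]
  norm_cast

theorem measurable_walkAverage_real (μ : Measure G) [IsProbabilityMeasure μ] (N : ℕ) {B : Set X}
    (hB : MeasurableSet B) : Measurable fun x : X => (walkAverage μ N x).real B := by
  simp only [walkAverage_real]
  exact (Finset.measurable_sum _ fun n _ =>
    (Kernel.measurable_coe (walkLaw X μ n) hB).ennreal_toReal).const_mul _

/-- A measurable transformation commuting with `G` commutes with the random walk. -/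
theorem walkLaw_map (μ : Measure G) [IsProbabilityMeasure μ] {T : X → X} (hT : Measurable T)
    (hcomm : ∀ (g : G) (x : X), T (g • x) = g • T x) (n : ℕ) (x : X) :
    (walkLaw X μ n x).map T = walkLaw X μ n (T x) := by
  ext B hB
  rw [Measure.map_apply hT hB]
  induction n generalizing x with
  | zero =>
    rw [walkLaw, Kernel.id_apply, Kernel.id_apply, Measure.dirac_apply' _ hB,
      Measure.dirac_apply' _ (hT hB)]
    rfl
  | succ n ih => simp only [walkLaw_succ_apply μ n _ hB, walkLaw_succ_apply μ n _ (hT hB), ih, hcomm]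

theorem walkAverage_map (μ : Measure G) [IsProbabilityMeasure μ] {T : X → X} (hT : Measurable T)
    (hcomm : ∀ (g : G) (x : X), T (g • x) = g • T x) (N : ℕ) (x : X) :
    (walkAverage μ N x).map T = walkAverage μ N (T x) := by
  simp only [walkAverage, Measure.map_smul, ← walkLaw_map μ hT hcomm]
  rw [← Measure.mapₗ_apply_of_measurable hT, map_sum]
  simp only [Measure.mapₗ_apply_of_measurable hT]

variable {μ : Measure G} [IsProbabilityMeasure μ] {ν : Measure X} [IsProbabilityMeasure ν]

/-- The isometry `f ↦ ((g, x) ↦ f (g • x))`. -/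
noncomputable def actionIsometry (h : IsStationaryMeasure μ ν) :
    Lp ℝ 2 ν →ₗᵢ[ℝ] Lp ℝ 2 (μ.prod ν) :=
  Lp.compMeasurePreservingₗᵢ ℝ _ h.measurePreserving

variable (μ ν) in
/-- The isometry `f ↦ ((g, x) ↦ f x)`. -/
noncomputable def sndIsometry : Lp ℝ 2 ν →ₗᵢ[ℝ] Lp ℝ 2 (μ.prod ν) :=
  Lp.compMeasurePreservingₗᵢ ℝ Prod.snd measurePreserving_snd

theorem coeFn_actionIsometry (h : IsStationaryMeasure μ ν) (f : Lp ℝ 2 ν) :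
    actionIsometry h f =ᵐ[μ.prod ν] fun q => f (q.1 • q.2) :=
  Lp.coeFn_compMeasurePreserving f h.measurePreserving

theorem coeFn_sndIsometry (f : Lp ℝ 2 ν) :
    sndIsometry μ ν f =ᵐ[μ.prod ν] fun q => f q.2 :=
  Lp.coeFn_compMeasurePreserving f measurePreserving_snd

/-- The Markov operator `f ↦ ∫ f (g • ·) dμ(g)` on `L²(ν)`. -/
noncomputable def markovOperator (h : IsStationaryMeasure μ ν) : Lp ℝ 2 ν →L[ℝ] Lp ℝ 2 ν :=
  -- The adjoint integrates out the group variable. As an adjoint of an isometry composed with an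
  -- isometry, the operator is visibly a contraction, and its fixed vectors can be analysed by inner
  -- products.
  (ContinuousLinearMap.adjoint (sndIsometry μ ν).toContinuousLinearMap) ∘L
    (actionIsometry h).toContinuousLinearMap

theorem inner_markovOperator (h : IsStationaryMeasure μ ν) (f w : Lp ℝ 2 ν) :
    inner ℝ (markovOperator h f) w = inner ℝ (actionIsometry h f) (sndIsometry μ ν w) := by
  simp [markovOperator, ContinuousLinearMap.adjoint_inner_left]

theorem norm_markovOperator_le (h : IsStationaryMeasure μ ν) : ‖markovOperator h‖ ≤ 1 := by
  refine (ContinuousLinearMap.opNorm_comp_le _ _).trans ?_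
  refine mul_le_one₀ ?_ (norm_nonneg _) (LinearIsometry.norm_toContinuousLinearMap_le _)
  rw [LinearIsometryEquiv.norm_map]
  exact LinearIsometry.norm_toContinuousLinearMap_le _

theorem markovOperator_toLp (h : IsStationaryMeasure μ ν) {u : X → ℝ} (hu : MemLp u 2 ν)
    (hv : MemLp (fun x => ∫ g, u (g • x) ∂μ) 2 ν) :
    markovOperator h (hu.toLp u) = hv.toLp _ := by
  refine ext_inner_right ℝ fun w => ?_
  rw [inner_markovOperator, L2.inner_def, L2.inner_def]
  have hae : (fun q => inner ℝ (actionIsometry h (hu.toLp u) q) (sndIsometry μ ν w q))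
      =ᵐ[μ.prod ν] fun q => w q.2 * u (q.1 • q.2) := by
    filter_upwards [coeFn_actionIsometry h (hu.toLp u), coeFn_sndIsometry (μ := μ) w,
      h.measurePreserving.quasiMeasurePreserving.ae hu.coeFn_toLp] with q h1 h2 h3
    rw [h1, h2, h3]
    rfl
  rw [integral_congr_ae hae,
    integral_prod_symm _ ((integrable_congr hae).mp (L2.integrable_inner _ _))]
  refine integral_congr_ae ?_
  filter_upwards [hv.coeFn_toLp] with x hx
  rw [hx, integral_const_mul]
  rfl

/-- Equality case of Cauchy–Schwarz: for a fixed f, the functions f(gx) and f(x) on G × X have norm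
‖f‖ and inner product ‖f‖², so they coincide. -/
theorem ae_eq_of_markovOperator_eq_self (h : IsStationaryMeasure μ ν) {f : Lp ℝ 2 ν}
    (hf : markovOperator h f = f) : ∀ᵐ q ∂(μ.prod ν), f (q.1 • q.2) = f q.2 := by
  have key : actionIsometry h f = sndIsometry μ ν f := by
    refine eq_of_norm_le_re_inner_eq_norm_sq (𝕜 := ℝ) ?_ ?_
    · rw [LinearIsometry.norm_map, LinearIsometry.norm_map]
    · rw [← inner_markovOperator, hf, LinearIsometry.norm_map, real_inner_self_eq_norm_sq]
      rfl
  filter_upwards [coeFn_actionIsometry h f, coeFn_sndIsometry (μ := μ) f] with q h1 h2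
  rw [← h1, ← h2, key]

theorem memLp_walkLaw_real (n : ℕ) {B : Set X} (hB : MeasurableSet B) :
    MemLp (fun x => (walkLaw X μ n x).real B) 2 ν :=
  MemLp.of_bound (Kernel.measurable_coe (walkLaw X μ n) hB).ennreal_toReal.aestronglyMeasurable 1
    (.of_forall fun x => by
      rw [Real.norm_of_nonneg measureReal_nonneg]; exact measureReal_le_one)

theorem memLp_walkAverage_real (N : ℕ) {B : Set X} (hB : MeasurableSet B) :
    MemLp (fun x => (walkAverage μ N x).real B) 2 ν :=
  MemLp.of_bound (measurable_walkAverage_real μ N hB).aestronglyMeasurable 1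
    (.of_forall fun x => by
      rw [Real.norm_of_nonneg measureReal_nonneg]; exact measureReal_le_one)

theorem iterate_markovOperator (h : IsStationaryMeasure μ ν) (n : ℕ) {B : Set X}
    (hB : MeasurableSet B) :
    (markovOperator h)^[n] ((memLp_walkLaw_real (μ := μ) 0 hB).toLp _)
      = (memLp_walkLaw_real (μ := μ) (ν := ν) n hB).toLp _ := by
  induction n with
  | zero => rfl
  | succ n ih =>
    have hv : MemLp (fun x => ∫ g, (walkLaw X μ n (g • x)).real B ∂μ) 2 ν := by
      simpa only [walkLaw_succ_real μ n _ hB] using memLp_walkLaw_real (μ := μ) (ν := ν) (n + 1) hB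
    rw [Function.iterate_succ_apply', ih, markovOperator_toLp h _ hv]
    simp only [walkLaw_succ_real μ n _ hB]

theorem birkhoffAverage_markovOperator (h : IsStationaryMeasure μ ν) (N : ℕ) {B : Set X}
    (hB : MeasurableSet B) :
    birkhoffAverage ℝ (markovOperator h) _root_.id (N + 1)
        ((memLp_walkLaw_real (μ := μ) 0 hB).toLp _)
      = (memLp_walkAverage_real (μ := μ) (ν := ν) N hB).toLp _ := by
  refine Lp.ext ?_
  rw [birkhoffAverage, birkhoffSum]
  simp only [_root_.id, iterate_markovOperator h _ hB]
  have h1 : ∀ᵐ x ∂ν, ∀ n, (memLp_walkLaw_real (μ := μ) (ν := ν) n hB).toLp _ x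
      = (walkLaw X μ n x).real B := ae_all_iff.mpr fun n => MemLp.coeFn_toLp _
  filter_upwards [Lp.coeFn_smul ((N + 1 : ℕ) : ℝ)⁻¹ (∑ n ∈ Finset.range (N + 1),
      (memLp_walkLaw_real (μ := μ) (ν := ν) n hB).toLp _), h1,
    Lp.coeFn_fun_finsetSum (Finset.range (N + 1)) fun n =>
      (memLp_walkLaw_real (μ := μ) (ν := ν) n hB).toLp _,
    (memLp_walkAverage_real (μ := μ) (ν := ν) N hB).coeFn_toLp] with x h2 h3 h4 h5
  rw [h2, h5, Pi.smul_apply, h4, walkAverage_real, smul_eq_mul]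
  simp only [h3]

end RandomWalk

/-! ### The mean ergodic theorem and generic points. -/

section GenericPoints

open Filter Topology

set_option linter.unusedSectionVars false

variable {G : Type*} [Group G] [TopologicalSpace G] [IsTopologicalGroup G] [LocallyCompactSpace G]
  [SecondCountableTopology G] [T2Space G] [MeasurableSpace G] [BorelSpace G]
  {X : Type*} [MeasurableSpace X] [MulAction G X] [MeasurableSMul₂ G X]
  {μ : Measure G} [IsProbabilityMeasure μ] {ν : Measure X} [IsProbabilityMeasure ν]

theorem markovOperator_one (h : IsStationaryMeasure μ ν) :
    markovOperator h ((memLp_const 1).toLp _) = (memLp_const 1).toLp _ := by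
  have hv : MemLp (fun _ : X => ∫ _ : G, (1 : ℝ) ∂μ) 2 ν := memLp_const _
  rw [markovOperator_toLp h _ hv]
  simp

/-- The mean ergodic theorem for the random walk. -/
theorem tendsto_eLpNorm_walkAverage (hμ : IsAdmissible μ) (h : IsStationaryMeasure μ ν)
    (herg : IsErgodicMeasure G ν) {B : Set X} (hB : MeasurableSet B) :
    Tendsto (fun N => eLpNorm (fun x => (walkAverage μ N x).real B - ν.real B) 2 ν) atTop
      (𝓝 0) := by
  let u : Lp ℝ 2 ν := (memLp_walkLaw_real (μ := μ) 0 hB).toLp _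
  let P := markovOperator h
  let F := P.eqLocus (1 : Lp ℝ 2 ν →L[ℝ] Lp ℝ 2 ν)
  let l : Lp ℝ 2 ν := F.orthogonalProjectionOnto u
  let e : Lp ℝ 2 ν := (memLp_const (1 : ℝ)).toLp _
  have hlim := P.tendsto_birkhoffAverage_orthogonalProjection (norm_markovOperator_le h) u
  have hfix : P l = l := (F.orthogonalProjectionOnto u).2
  obtain ⟨c, hc⟩ := herg.exists_ae_eq_const hμ h (Lp.stronglyMeasurable l).measurable
    (ae_eq_of_markovOperator_eq_self h hfix)
  have hinner (w : Lp ℝ 2 ν) : inner ℝ w e = ∫ x, w x ∂ν := by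
    rw [L2.inner_def]
    refine integral_congr_ae ?_
    filter_upwards [(memLp_const (μ := ν) (p := 2) (1 : ℝ)).coeFn_toLp] with x hx
    rw [hx]
    simp
  -- Projecting onto the fixed space preserves the pairing with the fixed vector 1, so the constant
  -- limit has the same integral as the indicator of `B`.
  have hle : inner ℝ l e = inner ℝ u e :=
    F.inner_orthogonalProjectionOnto_eq_of_mem_right ⟨e, markovOperator_one h⟩ u
  have hcB : c = ν.real B := by
    rw [hinner, hinner, integral_congr_ae hc, integral_congr_ae (MemLp.coeFn_toLp _)] at hle
    have h0 (x : X) : (walkLaw X μ 0 x).real B = B.indicator 1 x := by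
      rw [walkLaw, Kernel.id_apply, measureReal_def, Measure.dirac_apply' _ hB]
      by_cases hx : x ∈ B <;> simp [hx]
    simp only [h0, integral_indicator_one hB] at hle
    simpa using hle
  rw [Lp.tendsto_Lp_iff_tendsto_eLpNorm'] at hlim
  -- The shift matches `walkAverage` at `N` with the Birkhoff average of `N + 1` terms.
  refine ((tendsto_add_atTop_iff_nat 1).mpr hlim).congr fun N => eLpNorm_congr_ae ?_
  filter_upwards [hc, (memLp_walkAverage_real (μ := μ) (ν := ν) N hB).coeFn_toLp] with x h1 h2
  rw [Pi.sub_apply, birkhoffAverage_markovOperator h N hB, h2]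
  exact congrArg _ (h1.trans hcB)

/-- Diagonal choice: at time `N j` the first j + 1 errors have L¹ norm below 2⁻ʲ, so for each i the
tail from j = i is summable almost everywhere. The times need not increase, since only the limits
are used. -/
theorem exists_seq_ae_tendsto {E : ℕ → ℕ → X → ℝ}
    (hE : ∀ i N, AEStronglyMeasurable (E i N) ν)
    (hlim : ∀ i, Tendsto (fun N => eLpNorm (E i N) 1 ν) atTop (𝓝 0)) :
    ∃ N : ℕ → ℕ, ∀ᵐ x ∂ν, ∀ i, Tendsto (fun j => E i (N j) x) atTop (𝓝 0) := by
  have hN (j : ℕ) : ∃ N, ∀ i ∈ Finset.range (j + 1), eLpNorm (E i N) 1 ν < 2⁻¹ ^ j :=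
    ((eventually_all_finset _).mpr fun i _ =>
      (hlim i).eventually_lt_const (ENNReal.pow_pos (by simp) j)).exists
  choose N hN using hN
  refine ⟨N, ae_all_iff.mpr fun i => ?_⟩
  have hsum : ∫⁻ x, ∑' j, ‖E i (N (j + i)) x‖ₑ ∂ν ≠ ⊤ := by
    rw [lintegral_tsum fun j => (hE i _).enorm]
    refine ne_top_of_le_ne_top ENNReal.ofNat_ne_top
      ((ENNReal.tsum_le_tsum fun j => ?_).trans ENNReal.tsum_geometric_two.le)
    rw [← eLpNorm_one_eq_lintegral_enorm]
    exact (hN (j + i) i (by simp)).le.trans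
      (pow_le_pow_right_of_le_one' (by simp) (by omega))
  filter_upwards [ae_lt_top' (AEMeasurable.tsum fun j => (hE i _).enorm) hsum] with x hx
  rw [← tendsto_add_atTop_iff_nat i, tendsto_zero_iff_enorm_tendsto_zero]
  exact ENNReal.tendsto_atTop_zero_of_tsum_ne_top hx.ne

/-- A measure which is a probability measure, as an element of `ProbabilityMeasure`. -/
def asProbabilityMeasure (m : Measure X) [h : IsProbabilityMeasure m] : ProbabilityMeasure X :=
  ⟨m, h⟩

variable [TopologicalSpace X] [PolishSpace X] [BorelSpace X]

/-- Along a suitable subsequence, the Cesàro averages of the random walk started at almost every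
point converge to the ergodic stationary measure. -/
theorem exists_generic_set (hμ : IsAdmissible μ) (h : IsStationaryMeasure μ ν)
    (herg : IsErgodicMeasure G ν) :
    ∃ (N : ℕ → ℕ) (X₀ : Set X), MeasurableSet X₀ ∧ ν X₀ᶜ = 0 ∧ ∀ x ∈ X₀,
      Tendsto (fun j => asProbabilityMeasure (walkAverage μ (N j) x)) atTop
        (𝓝 (asProbabilityMeasure ν)) := by
  -- A countable π-system containing a basis: convergence of measures on it implies weak
  -- convergence, so only countably many null sets are discarded.
  let S := generateSetAlgebra (TopologicalSpace.countableBasis X)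
  have hmeas (s : Set X) (hs : s ∈ S) : MeasurableSet s := by
    induction hs with
    | base s hs => exact (TopologicalSpace.isOpen_of_mem_countableBasis hs).measurableSet
    | empty => exact .empty
    | compl s _ hs => exact hs.compl
    | union s t _ _ hs ht => exact hs.union ht
  have hpi : IsPiSystem S := fun s hs t ht _ =>
    (isSetAlgebra_generateSetAlgebra (𝒜 := TopologicalSpace.countableBasis X)).inter_mem hs ht
  obtain ⟨B, hB⟩ := (countable_generateSetAlgebra
    (TopologicalSpace.countable_countableBasis X)).exists_eq_range
      ⟨∅, generateSetAlgebra.empty⟩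
  have hBS (i : ℕ) : MeasurableSet (B i) := hmeas _ (by rw [show S = _ from hB]; exact ⟨i, rfl⟩)
  have hdm (i N : ℕ) : AEStronglyMeasurable
      (fun x => (walkAverage μ N x).real (B i) - ν.real (B i)) ν :=
    ((measurable_walkAverage_real μ N (hBS i)).sub_const _).aestronglyMeasurable
  obtain ⟨N, hN⟩ := exists_seq_ae_tendsto (ν := ν) hdm fun i =>
    tendsto_of_tendsto_of_tendsto_of_le_of_le tendsto_const_nhds
      (tendsto_eLpNorm_walkAverage hμ h herg (hBS i)) (fun _ => zero_le)
      fun N => eLpNorm_le_eLpNorm_of_exponent_le one_le_two (hdm i N)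
  refine ⟨N, (toMeasurable ν {x | ¬ ∀ i, Tendsto (fun j =>
    (walkAverage μ (N j) x).real (B i) - ν.real (B i)) atTop (𝓝 0)})ᶜ,
    (measurableSet_toMeasurable _ _).compl, ?_, fun x hx => ?_⟩
  · rw [compl_compl, measure_toMeasurable]
    exact hN
  · have hx' := not_not.mp fun hn => hx (subset_toMeasurable _ _ hn)
    refine hpi.tendsto_probabilityMeasure_of_tendsto_of_mem hmeas (fun U hU y hy => ?_)
      fun s hs => ?_
    · obtain ⟨V, hV, hyV, hVU⟩ :=
        (TopologicalSpace.isBasis_countableBasis X).exists_subset_of_mem_open hy hU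
      exact ⟨V, .base V hV, (TopologicalSpace.isOpen_of_mem_countableBasis hV).mem_nhds hyV, hVU⟩
    · obtain ⟨i, rfl⟩ : s ∈ Set.range B := hB ▸ hs
      rw [← NNReal.tendsto_coe]
      exact tendsto_sub_nhds_zero_iff.mp (hx' i)

/-- If `x` and `T x` are both generic for `ν`, where `T` commutes with `G`, then `T` preserves
`ν`. -/
theorem map_eq_self_of_tendsto_walkAverage {N : ℕ → ℕ} {T : X → X} (hT : Continuous T)
    (hcomm : ∀ (g : G) (x : X), T (g • x) = g • T x) {x : X}
    (hx : Tendsto (fun j => asProbabilityMeasure (walkAverage μ (N j) x)) atTop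
      (𝓝 (asProbabilityMeasure ν)))
    (hTx : Tendsto (fun j => asProbabilityMeasure (walkAverage μ (N j) (T x)))
      atTop (𝓝 (asProbabilityMeasure ν))) : ν.map T = ν := by
  have h1 := ProbabilityMeasure.tendsto_map_of_tendsto_of_continuous _ _ hx hT
  have h2 (j : ℕ) : (asProbabilityMeasure (walkAverage μ (N j) x)).map
      -- `T` carries the averages at `x` to those at `T x`, so both ν and its image are weak limits
      -- of one sequence.
      hT.measurable.aemeasurable = asProbabilityMeasure (walkAverage μ (N j) (T x)) :=
    Subtype.ext (walkAverage_map μ hT.measurable hcomm (N j) x)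
  simp only [h2] at h1
  exact congrArg ProbabilityMeasure.toMeasure (tendsto_nhds_unique h1 hTx)

end GenericPoints

/-! ### Existence and uniqueness of disintegrations. -/

section Disintegration

variable {X Y : Type*} [MeasurableSpace X] [MeasurableSpace Y]

/-- The fibre condition puts the joint law on the graph of `p`. The right side does not involve `κ`,
which yields uniqueness of disintegrations. -/
theorem IsDisintegration.compProd_eq {p : X → Y} (hp : Measurable p) {ν : Measure X}
    [IsProbabilityMeasure ν] {κ : Kernel Y X} (h : IsDisintegration p ν κ) :
    (ν.map p) ⊗ₘ κ = ν.map fun x => (p x, x) := by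
  have := h.isMarkovKernel
  have hm : Measurable fun x : X => (p x, x) := hp.prodMk measurable_id
  ext s hs
  rw [Measure.compProd_apply hs, Measure.map_apply hm hs]
  trans ((ν.map p).bind κ) ((fun x => (p x, x)) ⁻¹' s)
  swap
  · rw [h.bind_eq]
  rw [Measure.bind_apply (hm hs) κ.aemeasurable]
  refine lintegral_congr_ae ?_
  filter_upwards [h.ae_fiber] with y hy
  refine measure_congr ?_
  filter_upwards [measure_eq_zero_iff_ae_notMem.mp hy] with x hx
  have hxy : p x = y := not_not.mp hx
  exact propext (by rw [← hxy]; rfl)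

/-- Disintegrations are unique up to null sets. -/
theorem IsDisintegration.ae_eq [StandardBorelSpace X] {p : X → Y} (hp : Measurable p)
    {ν : Measure X} [IsProbabilityMeasure ν] {κ κ' : Kernel Y X} (h : IsDisintegration p ν κ)
    (h' : IsDisintegration p ν κ') : ∀ᵐ y ∂(ν.map p), κ y = κ' y := by
  have := h.isMarkovKernel
  have := h'.isMarkovKernel
  exact Kernel.ae_eq_of_compProd_eq ((h.compProd_eq hp).trans (h'.compProd_eq hp).symm)

/-- Condition the law of (p x, x) on its first coordinate; measurability of the diagonal of `Y` lets
concentration on the graph pass to the fibres. -/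
theorem exists_isDisintegration [StandardBorelSpace X] [MeasurableEq Y] {p : X → Y}
    (hp : Measurable p) (ν : Measure X) [IsProbabilityMeasure ν] :
    ∃ κ : Kernel Y X, IsDisintegration p ν κ := by
  have : Nonempty X := nonempty_of_isProbabilityMeasure ν
  have hm : Measurable fun x : X => (p x, x) := hp.prodMk measurable_id
  have : IsProbabilityMeasure (ν.map fun x => (p x, x)) :=
    Measure.isProbabilityMeasure_map hm.aemeasurable
  have hfst : (ν.map fun x => (p x, x)).fst = ν.map p := by
    rw [Measure.fst, Measure.map_map measurable_fst hm]
    rfl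
  have hsnd : (ν.map fun x => (p x, x)).snd = ν := by
    rw [Measure.snd, Measure.map_map measurable_snd hm]
    exact Measure.map_id
  have hdis := (ν.map fun x => (p x, x)).disintegrate (ν.map fun x => (p x, x)).condKernel
  rw [hfst] at hdis
  refine ⟨(ν.map fun x => (p x, x)).condKernel, inferInstance, ?_, ?_⟩
  · have hms : MeasurableSet {q : Y × X | p q.2 = q.1} :=
      measurableSet_eq_fun (hp.comp measurable_snd) measurable_fst
    refine Measure.ae_ae_of_ae_compProd (p := fun q : Y × X => p q.2 = q.1) ?_
    rw [hdis, ae_map_iff hm.aemeasurable hms]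
    exact .of_forall fun x => rfl
  · rw [← Measure.snd_compProd, hdis, hsnd]

/-- Almost everywhere equality of kernels can be tested upstairs. -/
theorem ae_map_kernel_eq [StandardBorelSpace X] {p : X → Y} (hp : Measurable p)
    {ν : Measure X} [IsProbabilityMeasure ν] {κ κ' : Kernel Y X} [IsFiniteKernel κ]
    [IsFiniteKernel κ'] (h : ∀ᵐ x ∂ν, κ (p x) = κ' (p x)) : ∀ᵐ y ∂(ν.map p), κ y = κ' y := by
  have : IsProbabilityMeasure (ν.map p) := Measure.isProbabilityMeasure_map hp.aemeasurable
  refine Kernel.ae_eq_of_compProd_eq ?_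
  ext s hs
  rw [Measure.compProd_apply hs, Measure.compProd_apply hs,
    lintegral_map (Kernel.measurable_kernel_prodMk_left hs) hp,
    lintegral_map (Kernel.measurable_kernel_prodMk_left hs) hp]
  refine lintegral_congr_ae ?_
  filter_upwards [h] with x hx
  rw [hx]

end Disintegration

/-! ### One-step averaging, to be applied to the stabilizer of ν in K. -/

section WalkBind

set_option linter.unusedSectionVars false

variable {G : Type*} [Group G] [MeasurableSpace G]
  {X : Type*} [MeasurableSpace X] [MulAction G X] [MeasurableSMul₂ G X]
  {μ : Measure G} [IsProbabilityMeasure μ] {ν : Measure X} [IsProbabilityMeasure ν]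

theorem isStationaryMeasure_of_map_eq (h : ∀ g : G, ν.map (fun x => g • x) = ν) :
    IsStationaryMeasure μ ν := by
  have hm : Measurable fun q : G × X => q.1 • q.2 := measurable_smul
  ext B hB
  rw [Measure.map_apply hm hB, Measure.prod_apply (hm hB)]
  have (g : G) : ν (Prod.mk g ⁻¹' ((fun q : G × X => q.1 • q.2) ⁻¹' B)) = ν B := by
    conv_rhs => rw [← h g, Measure.map_apply (measurable_const_smul g) hB]
    rfl
  simp [this]

theorem IsStationaryMeasure.bind_walkStep (h : IsStationaryMeasure μ ν) :
    ν.bind (walkStep X μ) = ν := by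
  have hm : Measurable fun q : G × X => q.1 • q.2 := measurable_smul
  conv_rhs => rw [← h]
  ext B hB
  rw [Measure.bind_apply hB (walkStep X μ).aemeasurable, Measure.map_apply hm hB,
    Measure.prod_apply_symm (hm hB)]
  refine lintegral_congr fun x => ?_
  rw [walkStep_apply, Measure.map_apply (measurable_smul_const x) hB]
  rfl

theorem walkStep_map {T : X → X} (hT : Measurable T)
    (hcomm : ∀ (g : G) (x : X), T (g • x) = g • T x) (x : X) :
    (walkStep X μ x).map T = walkStep X μ (T x) := by
  rw [walkStep_apply, walkStep_apply, Measure.map_map hT (measurable_smul_const x)]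
  simp only [Function.comp_def, hcomm]

/-- Right invariance absorbs the element `g`; for Haar measure on the stabilizer, this makes the
orbital average constant along orbits. -/
theorem walkStep_smul [MeasurableMul G] [μ.IsMulRightInvariant] (g : G) (x : X) :
    walkStep X μ (g • x) = walkStep X μ x := by
  rw [walkStep_apply, walkStep_apply]
  nth_rw 2 [← map_mul_right_eq_self μ g]
  rw [Measure.map_map (measurable_smul_const x) (measurable_mul_const g)]
  simp only [Function.comp_def, mul_smul]

end WalkBind

/-! ### The stabilizer of a measure is closed. -/

section StabilizerClosed

set_option linter.unusedSectionVars false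

variable {K : Type*} [Group K] [TopologicalSpace K] [FirstCountableTopology K]
  {X : Type*} [TopologicalSpace X] [PolishSpace X] [MeasurableSpace X] [BorelSpace X]
  [MulAction K X] [ContinuousSMul K X]

variable (K) in
/-- The subgroup of elements preserving a measure. -/
def measureStabilizer (ν : Measure X) : Subgroup K where
  carrier := {k | ν.map (fun x => k • x) = ν}
  one_mem' := by simp
  mul_mem' := by
    intro a b ha hb
    rw [Set.mem_ofPred_eq] at ha hb ⊢
    have : (fun x : X => (a * b) • x) = (fun x => a • x) ∘ fun x => b • x :=
      funext fun x => mul_smul a b x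
    rw [this, ← Measure.map_map (measurable_const_smul a) (measurable_const_smul b), hb, ha]
  inv_mem' := by
    intro a ha
    rw [Set.mem_ofPred_eq] at ha ⊢
    have : (fun x : X => a⁻¹ • x) ∘ (fun x => a • x) = id := funext fun x => inv_smul_smul a x
    nth_rw 1 [← ha]
    rw [Measure.map_map (measurable_const_smul a⁻¹) (measurable_const_smul a), this,
      Measure.map_id]

theorem mem_measureStabilizer {ν : Measure X} {k : K} :
    k ∈ measureStabilizer K ν ↔ ν.map (fun x => k • x) = ν := Iff.rfl

/-- Bounded continuous test functions determine a finite measure, and their integrals depend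
continuously on k by dominated convergence, which is where first countability of `K` enters. -/
theorem isClosed_measureStabilizer (ν : Measure X) [IsProbabilityMeasure ν] :
    IsClosed (measureStabilizer K ν : Set K) := by
  have hmap (k : K) (f : BoundedContinuousFunction X ℝ) :
      ∫ x, f x ∂(ν.map fun x => k • x) = ∫ x, f (k • x) ∂ν :=
    integral_map (measurable_const_smul k).aemeasurable f.continuous.aestronglyMeasurable
  have heq : (measureStabilizer K ν : Set K)
      = ⋂ f : BoundedContinuousFunction X ℝ, {k | ∫ x, f (k • x) ∂ν = ∫ x, f x ∂ν} := by
    ext k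
    simp only [Set.mem_iInter, Set.mem_ofPred_eq, SetLike.mem_coe, mem_measureStabilizer]
    refine ⟨fun hk f => by rw [← hmap, hk], fun hk => ?_⟩
    have : IsProbabilityMeasure (ν.map fun x => k • x) :=
      Measure.isProbabilityMeasure_map (measurable_const_smul k).aemeasurable
    exact ext_of_forall_integral_eq_of_IsFiniteMeasure fun f => (hmap k f).trans (hk f)
  rw [heq]
  refine isClosed_iInter fun f => isClosed_eq ?_ continuous_const
  refine continuous_of_dominated (bound := fun _ => ‖f‖) (fun k => ?_)
    (fun k => .of_forall fun x => f.norm_coe_le_norm _) (integrable_const _)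
    (.of_forall fun x => ?_)
  · exact (f.continuous.comp (continuous_const_smul k)).aestronglyMeasurable
  · exact f.continuous.comp (continuous_id.smul continuous_const)

end StabilizerClosed

/-! ### Fibre measures are orbital measures, hence equivariant. -/

section Core

set_option linter.unusedSectionVars false

variable {G : Type*} [Group G] [TopologicalSpace G] [IsTopologicalGroup G] [LocallyCompactSpace G]
  [SecondCountableTopology G] [T2Space G] [MeasurableSpace G] [BorelSpace G]
  {X : Type*} [TopologicalSpace X] [PolishSpace X] [MeasurableSpace X] [BorelSpace X]
  [MulAction G X] [ContinuousSMul G X]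
  {μ : Measure G} [IsProbabilityMeasure μ] {ν : Measure X} [IsProbabilityMeasure ν]

/-- The disintegration of an ergodic stationary measure over the orbits of a compact group
consists of orbital measures of the stabilizer of the measure. -/
theorem IsDisintegration.ae_eq_walkStep (hμ : IsAdmissible μ) (hst : IsStationaryMeasure μ ν)
    (herg : IsErgodicMeasure G ν)
    {K : Type*} [Group K] [TopologicalSpace K] [IsTopologicalGroup K]
    [SecondCountableTopology K] [MeasurableSpace K] [BorelSpace K]
    [MulAction K X] [ContinuousSMul K X] [SMulCommClass G K X]
    (m : Measure (measureStabilizer K ν)) [IsProbabilityMeasure m] [m.IsMulRightInvariant]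
    {Y : Type*} [MeasurableSpace Y] [MeasurableSingletonClass Y] {p : X → Y} (hp : Measurable p)
    (hporb : ∀ x x', p x = p x' ↔ x ∈ MulAction.orbit K x')
    {κ : Kernel Y X} (hκ : IsDisintegration p ν κ) :
    ∀ᵐ x ∂ν, κ (p x) = walkStep X m x := by
  have := hκ.isMarkovKernel
  obtain ⟨N, X₀, hX₀, hνX₀, hlim⟩ := exists_generic_set hμ hst herg
  let h := walkStep X m
  have hinv : IsStationaryMeasure m ν := isStationaryMeasure_of_map_eq fun k => k.2
  have hfib (y : Y) : MeasurableSet (p ⁻¹' {y})ᶜ := (hp (measurableSet_singleton y)).compl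
  -- Averaging over the stabilizer keeps each point in its fibre and preserves ν, so uniqueness will
  -- identify `h ∘ₖ κ` with `κ`.
  have hκ' : IsDisintegration p ν (h ∘ₖ κ) := by
    refine ⟨inferInstance, ?_, ?_⟩
    · filter_upwards [hκ.ae_fiber] with y hy
      rw [Kernel.comp_apply' _ _ _ (hfib y), lintegral_eq_zero_iff (Kernel.measurable_coe _ (hfib y))]
      filter_upwards [measure_eq_zero_iff_ae_notMem.mp hy] with x hx
      have hxy : p x = y := not_not.mp hx
      have (k : measureStabilizer K ν) : p (k • x) = y :=
        ((hporb _ _).mpr ⟨k, rfl⟩).trans hxy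
      rw [walkStep_apply, Measure.map_apply (measurable_smul_const x) (hfib y)]
      simp [Set.preimage, this]
    · rw [← Measure.comp_assoc, hκ.bind_eq]
      exact hinv.bind_walkStep
  have hX₀κ : ∀ᵐ y ∂(ν.map p), ∀ᵐ x ∂(κ y), x ∈ X₀ := by
    refine Measure.ae_ae_of_ae_comp ?_
    rw [hκ.bind_eq]
    exact hνX₀
  have hgood := hκ.ae_fiber.and (hX₀κ.and (hκ'.ae_eq hp hκ))
  filter_upwards [ae_of_ae_map hp.aemeasurable hgood, show ∀ᵐ x ∂ν, x ∈ X₀ from hνX₀]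
    with x ⟨h1, h2, h3⟩ hx
  rw [← h3]
  ext B hB
  rw [Kernel.comp_apply' _ _ _ hB]
  -- Almost every x' in the fibre is generic, like `x`, so an element carrying `x` to x' stabilizes
  -- ν and leaves `h` unchanged.
  have hconst : ∀ᵐ x' ∂(κ (p x)), h x' B = walkStep X m x B := by
    filter_upwards [measure_eq_zero_iff_ae_notMem.mp h1, h2] with x' hx' hx'₀
    obtain ⟨k, rfl⟩ := (hporb x' x).mp (not_not.mp hx')
    have hk : k ∈ measureStabilizer K ν :=
      map_eq_self_of_tendsto_walkAverage (continuous_const_smul k)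
        (fun g x => (smul_comm g k x).symm) (hlim x hx) (hlim _ hx'₀)
    exact congrArg (fun n : Measure X => n B) (walkStep_smul (μ := m) ⟨k, hk⟩ x)
  rw [lintegral_congr_ae hconst]
  simp

theorem IsDisintegration.isEquivariant (hμ : IsAdmissible μ) (hst : IsStationaryMeasure μ ν)
    (herg : IsErgodicMeasure G ν)
    {K : Type*} [Group K] [TopologicalSpace K] [IsTopologicalGroup K] [CompactSpace K]
    [SecondCountableTopology K] [MulAction K X] [ContinuousSMul K X] [SMulCommClass G K X]
    {Y : Type*} [MeasurableSpace Y] [MeasurableSingletonClass Y] [MulAction G Y]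
    [MeasurableConstSMul G Y] {p : X → Y} (hp : Measurable p)
    (hpsmul : ∀ (g : G) (x : X), p (g • x) = g • p x)
    (hporb : ∀ x x', p x = p x' ↔ x ∈ MulAction.orbit K x')
    {κ : Kernel Y X} (hκ : IsDisintegration p ν κ) : IsEquivariantDisintegration G p ν κ := by
  borelize K
  have := hκ.isMarkovKernel
  have : CompactSpace (measureStabilizer K ν) :=
    isCompact_iff_compactSpace.mp (isClosed_measureStabilizer ν).isCompact
  let m₀ : Measure (measureStabilizer K ν) := Measure.haarMeasure ⊤
  -- `haarMeasure` is left invariant; inversion gives the right invariance needed by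
  -- `walkStep_smul`.
  let m := m₀.inv
  have hm₀ : m₀ Set.univ = 1 := Measure.haarMeasure_self (K₀ := ⊤)
  have : IsProbabilityMeasure m := ⟨by rw [Measure.inv_apply, Set.inv_univ, hm₀]⟩
  have hae := hκ.ae_eq_walkStep hμ hst herg m hp hporb
  intro g
  -- Quasi-invariance makes the orbital formula available at g • x as well as at x.
  have hg := ((hst.preservesMeasureClass hμ).quasiMeasurePreserving g).ae hae
  have : IsMarkovKernel (κ.map fun x => g • x) :=
    Kernel.IsMarkovKernel.map κ (measurable_const_smul g)
  have key : ∀ᵐ x ∂ν, κ.comap (fun y => g • y) (measurable_const_smul g) (p x)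
      = κ.map (fun x => g • x) (p x) := by
    filter_upwards [hae, hg] with x h1 h2
    rw [Kernel.comap_apply, Kernel.map_apply _ (measurable_const_smul g), h1, ← hpsmul, h2]
    exact (walkStep_map (measurable_const_smul g) (fun k x => smul_comm g k x) x).symm
  filter_upwards [ae_map_kernel_eq hp key] with y hy
  rwa [Kernel.comap_apply, Kernel.map_apply _ (measurable_const_smul g)] at hy

end Core

/-! ### Reduction to second countable compact groups. -/

section EffectiveQuotient

variable (K X : Type*) [Group K] [MulAction K X]

/-- The quotient of a group by the kernel of its action on `X`. -/
abbrev EffectiveQuotient := K ⧸ (MulAction.toPermHom K X).ker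

instance effectiveQuotientMulAction : MulAction (EffectiveQuotient K X) X :=
  MulAction.compHom X (QuotientGroup.kerLift (MulAction.toPermHom K X))

variable {K X}

theorem orbit_effectiveQuotient (x : X) :
    MulAction.orbit (EffectiveQuotient K X) x = MulAction.orbit K x := by
  ext y
  constructor
  · rintro ⟨q, rfl⟩
    obtain ⟨k, rfl⟩ := QuotientGroup.mk_surjective q
    exact ⟨k, rfl⟩
  · rintro ⟨k, rfl⟩
    exact ⟨(k : EffectiveQuotient K X), rfl⟩

instance effectiveQuotientSMulCommClass {G : Type*} [Group G] [MulAction G X]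
    [SMulCommClass G K X] : SMulCommClass G (EffectiveQuotient K X) X where
  smul_comm g q x := by
    obtain ⟨k, rfl⟩ := QuotientGroup.mk_surjective q
    exact smul_comm g k x

theorem effectiveQuotient_ext {q r : EffectiveQuotient K X} (h : ∀ x : X, q • x = r • x) :
    q = r :=
  QuotientGroup.kerLift_injective _ (Equiv.ext h)

variable [TopologicalSpace K] [IsTopologicalGroup K] [TopologicalSpace X] [ContinuousSMul K X]

instance effectiveQuotientContinuousSMul : ContinuousSMul (EffectiveQuotient K X) X where
  continuous_smul := by
    have h := (QuotientGroup.isOpenQuotientMap_mk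
      (N := (MulAction.toPermHom K X).ker)).prodMap (IsOpenQuotientMap.id (X := X))
    rw [h.isQuotientMap.continuous_iff]
    exact continuous_smul (M := K) (X := X)

/-- A compact group acting effectively on a separable metrizable space is second countable. -/
instance effectiveQuotientSecondCountable [CompactSpace K] [T2Space X]
    [SecondCountableTopology X] : SecondCountableTopology (EffectiveQuotient K X) := by
  obtain ⟨D, hDc, hDd⟩ := TopologicalSpace.exists_countable_dense X
  have := hDc.to_subtype
  -- Evaluation on a countable dense set is injective by effectiveness, so compactness makes it an
  -- embedding into a countable power of `X`.
  let f : EffectiveQuotient K X → D → X := fun q d => q • (d : X)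
  have hf : Continuous f := continuous_pi fun d => continuous_id.smul continuous_const
  have hinj : Function.Injective f := fun q r hqr => effectiveQuotient_ext fun x =>
    congrFun (Continuous.ext_on hDd (continuous_const_smul q) (continuous_const_smul r)
      fun d hd => congrFun hqr ⟨d, hd⟩) x
  exact (hf.isClosedEmbedding hinj).isEmbedding.secondCountableTopology

end EffectiveQuotient

theorem mainTheorem12
    {G : Type*} [Group G] [TopologicalSpace G] [IsTopologicalGroup G] [LocallyCompactSpace G]
    [SecondCountableTopology G] [T2Space G] [MeasurableSpace G] [BorelSpace G]
    (μ : Measure G) [IsProbabilityMeasure μ] (hμ : IsAdmissible μ)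
    {X : Type*} [TopologicalSpace X] [PolishSpace X] [MeasurableSpace X] [BorelSpace X]
    [MulAction G X] [ContinuousSMul G X]
    {K : Type*} [Group K] [TopologicalSpace K] [IsTopologicalGroup K] [CompactSpace K] [T2Space K]
    [MulAction K X] [ContinuousSMul K X] [SMulCommClass G K X] :
    IsStiffRelativeTo μ (Quotient.mk (MulAction.orbitRel K X)) := by
  have hcont : Continuous (Quotient.mk (MulAction.orbitRel K X)) := continuous_quotient_mk'
  have hp : Measurable (Quotient.mk (MulAction.orbitRel K X)) :=
    hcont.measurable (γ := MulAction.orbitRel.Quotient K X)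
  -- Equivariance is applied to `EffectiveQuotient K X`, which is second countable and has the same
  -- orbits as `K`.
  refine ⟨hcont, Quotient.mk_surjective, fun g x => rfl, fun ν _ hst herg =>
    ⟨hst.preservesMeasureClass hμ,
      exists_isDisintegration (Y := MulAction.orbitRel.Quotient K X) hp ν, fun κ hκ =>
      hκ.isEquivariant (Y := MulAction.orbitRel.Quotient K X) (K := EffectiveQuotient K X)
        hμ hst herg hp (fun g x => rfl) fun x x' => ?_⟩⟩
  rw [orbit_effectiveQuotient]
  exact Quotient.eq
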